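/- Let $L$ be a countable first-order language, let $\kappa$ be an uncountable cardinal, and let $\mathfrak C$ be a $\kappa$-saturated and strongly $\kappa$-homogeneous $L$-structure (a monster model of its complete theory). Let $A\subseteq\mathfrak C$ with $|A|<\kappa$, and let $p(x)\in S_n(A)$ be a complete type, $n<\omega$, such that - $p$ is definable: for every $L$-formula $\varphi(x,y)$ there is a formula $\psi(y)$ with parameters in $A$ such that, for all tuples $b$ from $A$, $\varphi(x,b)\in p$ if and only if $\mathfrak C\models\psi(b)$; - $p$ is stable: there are no $L$-formula $\varphi(x,y)$, realizations $(a_i)_{i<\omega}$ of $p$ in $\mathfrak C$ and tuples $(b_j)_{j<\omega}$ in $\mathfrak C$ such that $\mathfrak C\models\varphi(a_i,b_j)$ if and only if $i<j$. Let $A\subseteq B\subseteq\mathfrak C$ and let $q(x)\in S_n(B)$ be a coheir of $p$, that is, $q$ extends $p$ and every finite subset of $q$ is realized by a tuple from $A$. Then $q$ is an ultralimit of $p$ via a countably incomplete ultrafilter on $\omega$: there are an ultrafilter $\mathcal U$ on $\omega$ that is not closed under countable intersections, and a sequence $(a_i)_{i<\omega}$ of $n$-tuples from $A$, such that $$p=\{\varphi(x)\in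 L(A) : \{i<\omega : \mathfrak C\models\varphi(a_i)\}\in\mathcal U\}\quad\text{and}\quad q=\{\varphi(x)\in L(B) : \{i<\omega : \mathfrak C\models\varphi(a_i)\}\in\mathcal U\}.$$ -/

import Mathlib

open FirstOrder FirstOrder.Language Cardinal

universe u v w

namespace CoheirUltralimit



section

variable (L : FirstOrder.Language.{u, v}) (C : Type w) [L.Structure C]

/-- `C` is `κ`-saturated: every partial type in fewer than `κ` variables, over fewer than `κ`
parameters, that is finitely satisfiable in `C` is realized in `C`. (For infinite `κ` this is
equivalent to the same condition for types in one variable.) -/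
def IsSaturated (κ : Cardinal.{w}) : Prop :=
  ∀ A : Set C, #A < κ → ∀ α : Type w, #α < κ → ∀ Γ : Set (L[[A]].Formula α),
    (∀ Γ₀ : Finset (L[[A]].Formula α), (Γ₀ : Set (L[[A]].Formula α)) ⊆ Γ →
      ∃ v : α → C, ∀ φ ∈ Γ₀, φ.Realize v) →
    ∃ v : α → C, ∀ φ ∈ Γ, φ.Realize v

/-- `C` is strongly `κ`-homogeneous: every partial elementary map between subsets of `C` of
cardinality less than `κ` extends to an automorphism of `C`. -/
def IsStronglyHomogeneous (κ : Cardinal.{w}) : Prop :=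
  ∀ α : Type w, #α < κ → ∀ a b : α → C,
    (∀ φ : L.Formula α, φ.Realize a ↔ φ.Realize b) → ∃ σ : C ≃[L] C, ∀ i, σ (a i) = b i

/-- `C` is a monster model (of its complete theory), where `small` means `of cardinality < κ`. -/
structure IsMonster (κ : Cardinal.{w}) : Prop where
  aleph0_lt : ℵ₀ < κ
  saturated : IsSaturated L C κ
  homogeneous : IsStronglyHomogeneous L C κ

end

section

variable (L : FirstOrder.Language.{u, v}) {C : Type w} [L.Structure C]

/-- `S_n(A)`: the complete `n`-types over the parameter set `A ⊆ C`. -/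
abbrev TypeOver (A : Set C) (n : ℕ) : Type _ :=
  (L[[A]].completeTheory C).CompleteType (Fin n)

/-- `tp(a/A)`: the complete type over `A` of a tuple `a` from `C`. -/
abbrev tp [Nonempty C] (A : Set C) {n : ℕ} (a : Fin n → C) : TypeOver L A n :=
  (L[[A]].completeTheory C).typeOf a

end

variable {L : FirstOrder.Language.{u, v}} {C : Type w} [L.Structure C]

/-- The set of formulas `φ(x)` with parameters in `A` that belong to the type `p(x)`. -/
def formulas {A : Set C} {n : ℕ} (p : TypeOver L A n) : Set (L[[A]].Formula (Fin n)) :=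
  {φ | Formula.equivSentence φ ∈ p}

/-- The formula `φ(x, b)` obtained from `φ(x, y)` by substituting a tuple `b` from `A` for `y`. -/
def instantiate {A : Set C} {n m : ℕ} (φ : L.Formula (Fin n ⊕ Fin m)) (b : Fin m → A) :
    L[[A]].Formula (Fin n) :=
  BoundedFormula.subst ((L.lhomWithConstants A).onFormula φ)
    (Sum.elim Term.var fun j => (L.con (b j)).term)

/-- A formula with parameters in `A`, regarded as a formula with parameters in `B ⊇ A`. -/
def liftParams {A B : Set C} (hAB : A ⊆ B) {n : ℕ} (φ : L[[A]].Formula (Fin n)) :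
    L[[B]].Formula (Fin n) :=
  (L.lhomWithConstantsMap (Set.inclusion hAB)).onFormula φ

/-- `p ∈ S_n(A)` is definable: for each `φ(x, y)` there is a formula `ψ(y)` with parameters in `A`
such that, for all `b` from `A`, `φ(x, b) ∈ p` if and only if `ψ(b)` holds. -/
def IsDefinableType {A : Set C} {n : ℕ} (p : TypeOver L A n) : Prop :=
  ∀ (m : ℕ) (φ : L.Formula (Fin n ⊕ Fin m)), ∃ ψ : L[[A]].Formula (Fin m),
    ∀ b : Fin m → A, instantiate φ b ∈ formulas p ↔ ψ.Realize fun j => (b j : C)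

/-- `p ∈ S_n(A)` is stable: no formula `φ(x, y)` has the order property on realizations of `p`
(to be used inside a monster model). -/
def IsStableType [Nonempty C] {A : Set C} {n : ℕ} (p : TypeOver L A n) : Prop :=
  ¬ ∃ (m : ℕ) (φ : L.Formula (Fin n ⊕ Fin m)) (a : ℕ → Fin n → C) (b : ℕ → Fin m → C),
    (∀ i, tp L A (a i) = p) ∧ ∀ i j, φ.Realize (Sum.elim (a i) (b j)) ↔ i < j

/-- `q ∈ S_n(B)` is a coheir of `p ∈ S_n(A)`: `q` extends `p` and is finitely satisfiable
in `A`. -/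
structure IsCoheir {A B : Set C} (hAB : A ⊆ B) {n : ℕ} (p : TypeOver L A n)
    (q : TypeOver L B n) : Prop where
  extends_type : ∀ φ ∈ formulas p, liftParams hAB φ ∈ formulas q
  finitely_satisfiable : ∀ Γ : Finset (L[[B]].Formula (Fin n)),
    (Γ : Set (L[[B]].Formula (Fin n))) ⊆ formulas q →
      ∃ a : Fin n → A, ∀ φ ∈ Γ, φ.Realize fun i => (a i : C)

/-- An ultrafilter is countably incomplete if it is not closed under countable intersections. -/
def IsCountablyIncomplete {I : Type*} (U : Ultrafilter I) : Prop :=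
  ∃ s : ℕ → Set I, (∀ k, s k ∈ U) ∧ (⋂ k, s k) ∉ U

/-- The ultraproduct `∏_U P_i = {φ : {i : φ ∈ P_i} ∈ U}` of a family of sets of formulas. -/
def filterUltraproduct {I F : Type*} (U : Ultrafilter I) (P : I → Set F) : Set F :=
  {φ | {i | φ ∈ P i} ∈ U}

/-- `q ∈ S_n(B)` is an ultralimit of `p ∈ S_n(A)` via `U`: for some family `(a_i)` of tuples
from `A`, the `U`-limit of the types `tp(a_i/A)` is `p` and that of `tp(a_i/B)` is `q`. -/
def IsUltralimit [Nonempty C] {I : Type*} (U : Ultrafilter I) {A B : Set C} {n : ℕ}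
    (p : TypeOver L A n) (q : TypeOver L B n) : Prop :=
  ∃ a : I → Fin n → A,
    filterUltraproduct U (fun i => formulas (tp L A fun k => (a i k : C))) = formulas p ∧
    filterUltraproduct U (fun i => formulas (tp L B fun k => (a i k : C))) = formulas q

end CoheirUltralimit

open Filter

namespace CoheirUltralimit

/-! The coheir is the limit of an actual sequence in `A`, so every nonprincipal ultrafilter on `ℕ`
works. By compactness, stability gives for each `φ(x, y)` a finite part of `p` on whose solutions
`φ` has no order property (`exists_finset_no_order`). As there are countably many `φ`, the `i`-th
term need only respect the first `i` of these finite parts, together with finitely many formulas of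
`q`; finite satisfiability in `A` supplies it. If these formulas are chosen to refute earlier terms
whenever possible, an instance of `φ` in `q` failing infinitely often would yield the order property
(`exists_seq_eventually_of_no_order`). `B` may be arbitrarily large. -/

/-- Combinatorial core: if every finite part of `⋃ k, S k` is satisfied by points of `X` satisfying
finitely many of the conditions `θ k`, and `R` has no order property between the points satisfying
`θ k` and `S k`, then a sequence in `X` eventually satisfies each element of `⋃ k, S k`. -/
lemma exists_seq_eventually_of_no_order {X Y : Type*} (R : X → Y → Prop) (S : ℕ → Set Y)
    (θ : ℕ → X → Prop)
    (hfin : ∀ (i : ℕ) (W : Finset Y), (W : Set Y) ⊆ ⋃ k, S k →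
      ∃ x, (∀ k < i, θ k x) ∧ ∀ y ∈ W, R x y)
    (hord : ∀ k, ¬ ∃ (a : ℕ → X) (b : ℕ → Y), (∀ i, θ k (a i)) ∧ (∀ j, b j ∈ S k) ∧
      ∀ i j, R (a i) (b j) ↔ j ≤ i) :
    ∃ a : ℕ → X, ∀ k, ∀ y ∈ S k, ∀ᶠ i in atTop, R (a i) y := by
  classical
  -- `T k F` holds one element of `S k` that fails at every point of `F`, if there is one.
  have hT : ∀ (k : ℕ) (F : Finset X), ∃ T : Finset Y, (T : Set Y) ⊆ S k ∧
      ((∃ y ∈ S k, ∀ x ∈ F, ¬ R x y) → ∃ y ∈ T, ∀ x ∈ F, ¬ R x y) := by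
    intro k F
    by_cases h : ∃ y ∈ S k, ∀ x ∈ F, ¬ R x y
    · obtain ⟨y, hy, hF⟩ := h
      exact ⟨{y}, by simpa using hy, fun _ => ⟨y, by simp, hF⟩⟩
    · exact ⟨∅, by simp, fun h' => absurd h' h⟩
  choose T hTS hTF using hT
  have hstep : ∀ (i : ℕ) (F : Finset X), ∃ x, ∀ k < i, θ k x ∧
      ∀ G ⊆ F, ∀ y ∈ T k G, R x y := by
    intro i F
    obtain ⟨x, hθ, hx⟩ := hfin i ((Finset.range i).biUnion fun k => F.powerset.biUnion (T k)) (by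
      intro y hy
      simp only [Finset.mem_coe, Finset.mem_biUnion] at hy
      obtain ⟨k, -, G, -, hy⟩ := hy
      exact Set.mem_iUnion.2 ⟨k, hTS k G hy⟩)
    refine ⟨x, fun k hk => ⟨hθ k hk, fun G hG y hy => hx y ?_⟩⟩
    simp only [Finset.mem_biUnion]
    exact ⟨k, Finset.mem_range.2 hk, G, Finset.mem_powerset.2 hG, hy⟩
  choose g hg using hstep
  -- `P i` collects the terms before the `i`-th, which is `g i (P i)`.
  let P : ℕ → Finset X := fun i => Nat.rec ∅ (fun i F => insert (g i F) F) i
  have hP : ∀ i, P (i + 1) = insert (g i (P i)) (P i) := fun i => rfl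
  have hmono : Monotone P := monotone_nat_of_le_succ fun i => by
    rw [hP]; exact Finset.subset_insert _ _
  have hmem : ∀ {i j}, i < j → g i (P i) ∈ P j := fun {i j} hij =>
    hmono (Nat.succ_le_of_lt hij) (by rw [Nat.succ_eq_add_one, hP]; exact Finset.mem_insert_self _ _)
  refine ⟨fun i => g i (P i), fun k y hy => ?_⟩
  by_contra hcon
  -- Indices beyond `k` are kept, since only those terms respect `θ k` and the witnesses from `T k`.
  obtain ⟨s, hs, hsP⟩ := extraction_of_frequently_atTop
    ((not_eventually.1 hcon).and_eventually (eventually_gt_atTop k))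
  -- `y` fails at all the chosen terms, so `T k` of the first `j` of them is nonempty.
  have hb : ∀ j, ∃ z ∈ T k ((Finset.range j).image fun l => g (s l) (P (s l))),
      ∀ l < j, ¬ R (g (s l) (P (s l))) z := by
    intro j
    obtain ⟨z, hz, hzF⟩ := hTF k ((Finset.range j).image fun l => g (s l) (P (s l)))
      ⟨y, hy, fun x hx => by
        obtain ⟨l, -, rfl⟩ := Finset.mem_image.1 hx
        exact (hsP l).1⟩
    exact ⟨z, hz, fun l hl => hzF _ (Finset.mem_image_of_mem _ (Finset.mem_range.2 hl))⟩
  choose b hbT hbR using hb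
  refine hord k ⟨fun l => g (s l) (P (s l)), b, fun l => (hg _ _ k (hsP l).2).1,
    fun j => hTS _ _ (hbT j), fun l j => ⟨fun h => ?_, fun h => ?_⟩⟩
  · by_contra hjl
    exact hbR j l (not_le.1 hjl) h
  · refine (hg _ _ k (hsP l).2).2 _ ?_ _ (hbT j)
    intro x hx
    obtain ⟨r, hr, rfl⟩ := Finset.mem_image.1 hx
    exact hmem (hs ((Finset.mem_range.1 hr).trans_le h))

/-! ### Types and their formulas -/

variable {L : FirstOrder.Language.{u, v}} {C : Type w} [L.Structure C]

lemma mem_formulas_tp [Nonempty C] {A : Set C} {n : ℕ} {a : Fin n → C}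
    {φ : L[[A]].Formula (Fin n)} : φ ∈ formulas (tp L A a) ↔ φ.Realize a :=
  Theory.CompleteType.formula_mem_typeOf (T := L[[A]].completeTheory C)

lemma not_mem_formulas {A : Set C} {n : ℕ} (p : TypeOver L A n) (φ : L[[A]].Formula (Fin n)) :
    φ.not ∈ formulas p ↔ φ ∉ formulas p :=
  p.not_mem_iff (Formula.equivSentence φ)

lemma realize_liftParams {A B : Set C} (hAB : A ⊆ B) {n : ℕ} {φ : L[[A]].Formula (Fin n)}
    {a : Fin n → C} : (liftParams hAB φ).Realize a ↔ φ.Realize a :=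
  LHom.realize_onFormula _ _

lemma formulas_injective {A : Set C} {n : ℕ} :
    Function.Injective (formulas : TypeOver L A n → Set (L[[A]].Formula (Fin n))) := by
  intro p q h
  refine SetLike.ext fun χ => ?_
  obtain ⟨φ, rfl⟩ := Formula.equivSentence.surjective χ
  exact Set.ext_iff.1 h φ

lemma eq_of_formulas_subset {A : Set C} {n : ℕ} {p q : TypeOver L A n}
    (h : formulas p ⊆ formulas q) : p = q := by
  refine formulas_injective (h.antisymm fun φ hφ => ?_)
  by_contra hp
  exact (not_mem_formulas q φ).1 (h ((not_mem_formulas p φ).2 hp)) hφ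

/-- Every formula with parameters is an instance of a formula without parameters. -/
lemma exists_formula_realize_iff {B : Set C} {n : ℕ} (χ : L[[B]].Formula (Fin n)) :
    ∃ (m : ℕ) (φ : L.Formula (Fin n ⊕ Fin m)) (b : Fin m → C),
      ∀ a : Fin n → C, χ.Realize a ↔ φ.Realize (Sum.elim a b) := by
  classical
  -- Parameters become variables; the finitely many that occur are then numbered.
  let χ' : L.Formula (B ⊕ Fin n) := BoundedFormula.constantsVarsEquiv χ
  let s : Finset B := χ'.freeVarFinset.toLeft
  have hs : ∀ b : B, Sum.inl b ∈ χ'.freeVarFinset → b ∈ s := fun b hb => by simpa [s] using hb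
  let f : χ'.freeVarFinset → Fin n ⊕ Fin s.card := fun x => match x with
    | ⟨Sum.inl b, hb⟩ => Sum.inr (s.equivFin ⟨b, hs b hb⟩)
    | ⟨Sum.inr i, _⟩ => Sum.inl i
  refine ⟨s.card, BoundedFormula.restrictFreeVar χ' f, fun j => ((s.equivFin.symm j : B) : C),
    fun a => ?_⟩
  refine (BoundedFormula.realize_constantsVarsEquiv (φ := χ)).symm.trans
    (BoundedFormula.realize_restrictFreeVar _ ?_).symm
  rintro ⟨b | i, hx⟩
  · simp [f]
  · simp [f]

/-- By saturation, a stable type contains finitely many formulas on whose solutions a given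
formula does not have the order property. -/
lemma exists_finset_no_order [Nonempty C] {κ : Cardinal.{w}} (hC : IsMonster L C κ) {A : Set C}
    (hA : #A < κ) {n : ℕ} {p : TypeOver L A n} (hst : IsStableType p) {m : ℕ}
    (φ : L.Formula (Fin n ⊕ Fin m)) :
    ∃ Γ : Finset (L[[A]].Formula (Fin n)), (Γ : Set (L[[A]].Formula (Fin n))) ⊆ formulas p ∧
      ¬ ∃ (a : ℕ → Fin n → C) (b : ℕ → Fin m → C), (∀ i, ∀ θ ∈ Γ, θ.Realize (a i)) ∧
        ∀ i j, φ.Realize (Sum.elim (a i) (b j)) ↔ j ≤ i := by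
  classical
  by_contra! hcon
  let α : Type w := ULift.{w} (ℕ × (Fin n ⊕ Fin m))
  have hα : #α < κ := by
    refine lt_of_le_of_lt ?_ hC.aleph0_lt
    exact Cardinal.mk_le_aleph0_iff.2 inferInstance
  let onType (i : ℕ) (θ : L[[A]].Formula (Fin n)) : L[[A]].Formula α :=
    θ.relabel fun k => ULift.up (i, Sum.inl k)
  let onPair (i j : ℕ) : L[[A]].Formula α :=
    ((L.lhomWithConstants A).onFormula φ).relabel
      (Sum.elim (fun k => ULift.up (i, Sum.inl k)) fun k => ULift.up (j, Sum.inr k))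
  have h_onType : ∀ i θ (v : α → C),
      (onType i θ).Realize v ↔ θ.Realize fun k => v ⟨(i, Sum.inl k)⟩ := fun i θ v => by
    simp only [onType, Formula.realize_relabel]; rfl
  have h_onPair : ∀ i j (v : α → C), (onPair i j).Realize v ↔
      φ.Realize (Sum.elim (fun k => v ⟨(i, Sum.inl k)⟩) fun k => v ⟨(j, Sum.inr k)⟩) :=
    fun i j v => by
      simp only [onPair, Formula.realize_relabel, LHom.realize_onFormula, Sum.comp_elim]; rfl
  let Δ : Set (L[[A]].Formula α) :=
    {γ | (∃ i, ∃ θ ∈ formulas p, γ = onType i θ) ∨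
      ∃ i j, γ = if j ≤ i then onPair i j else (onPair i j).not}
  -- Each condition uses at most one formula of `p`, so finitely many conditions need only a finite
  -- `Γ`.
  have hlocal : ∀ γ ∈ Δ, ∃ Γ : Finset (L[[A]].Formula (Fin n)),
      (Γ : Set (L[[A]].Formula (Fin n))) ⊆ formulas p ∧ ∀ v : α → C,
        (∀ i, ∀ θ ∈ Γ, θ.Realize fun k => v ⟨(i, Sum.inl k)⟩) →
        (∀ i j, φ.Realize (Sum.elim (fun k => v ⟨(i, Sum.inl k)⟩) fun k => v ⟨(j, Sum.inr k)⟩) ↔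
          j ≤ i) → γ.Realize v := by
    rintro γ (⟨i, θ, hθ, rfl⟩ | ⟨i, j, rfl⟩)
    · exact ⟨{θ}, by simpa using hθ, fun v hv _ => (h_onType _ _ _).2 (hv i θ (by simp))⟩
    · refine ⟨∅, by simp, fun v _ hv => ?_⟩
      split_ifs with hij
      · exact (h_onPair _ _ _).2 ((hv i j).2 hij)
      · rw [Formula.realize_not, h_onPair, hv]
        exact hij
  choose! Γ hΓp hΓ using hlocal
  obtain ⟨v, hv⟩ := hC.saturated A hA α hα Δ (by
    intro Δ₀ hΔ₀
    obtain ⟨a, b, ha, hab⟩ := hcon (Δ₀.biUnion Γ) (by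
      intro θ hθ
      obtain ⟨γ, hγ, hθ⟩ := Finset.mem_biUnion.1 hθ
      exact hΓp γ (hΔ₀ hγ) hθ)
    refine ⟨fun x => Sum.elim (a x.down.1) (b x.down.1) x.down.2, fun γ hγ => ?_⟩
    exact hΓ γ (hΔ₀ hγ) _ (fun i θ hθ => ha i θ (Finset.mem_biUnion.2 ⟨γ, hγ, hθ⟩)) hab)
  -- Negation turns the pattern `j ≤ i` into the `i < j` of the stability hypothesis.
  refine hst ⟨m, φ.not, fun i k => v ⟨(i, Sum.inl k)⟩, fun j k => v ⟨(j, Sum.inr k)⟩,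
    fun i => ?_, fun i j => ?_⟩
  · refine (eq_of_formulas_subset fun θ hθ => mem_formulas_tp.2 ?_).symm
    exact (h_onType _ _ _).1 (hv _ (Or.inl ⟨i, θ, hθ, rfl⟩))
  · have h := hv _ (Or.inr ⟨i, j, rfl⟩)
    rw [Formula.realize_not, ← h_onPair]
    split_ifs at h with hij
    · exact ⟨fun h' => absurd h h', fun h' => absurd hij (not_le.2 h')⟩
    · exact ⟨fun _ => not_le.1 hij, fun _ => Formula.realize_not.1 h⟩

/-- A coheir of a stable type is the limit of a sequence of tuples from the base set. -/
lemma exists_seq_eventually_realize [Countable L.Symbols] [Nonempty C] {κ : Cardinal.{w}}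
    (hC : IsMonster L C κ) {A : Set C} (hA : #A < κ) {n : ℕ} {p : TypeOver L A n}
    (hst : IsStableType p) {B : Set C} {hAB : A ⊆ B} {q : TypeOver L B n}
    (hq : IsCoheir hAB p q) :
    ∃ a : ℕ → Fin n → A, ∀ χ ∈ formulas q, ∀ᶠ i in atTop, χ.Realize fun k => (a i k : C) := by
  classical
  have : Nonempty (Σ m, L.Formula (Fin n ⊕ Fin m)) := ⟨⟨0, ⊥⟩⟩
  obtain ⟨e, he⟩ := exists_surjective_nat (Σ m, L.Formula (Fin n ⊕ Fin m))
  choose Γ hΓp hΓ using fun k => exists_finset_no_order hC hA hst (e k).2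
  -- The instances may have parameters anywhere in `C`, as the definition of stability allows.
  let S : ℕ → Set (L[[B]].Formula (Fin n)) := fun k =>
    {χ | χ ∈ formulas q ∧ ∃ b : Fin (e k).1 → C,
      ∀ a : Fin n → C, χ.Realize a ↔ (e k).2.Realize (Sum.elim a b)}
  have hfin : ∀ (i : ℕ) (W : Finset (L[[B]].Formula (Fin n))),
      (W : Set (L[[B]].Formula (Fin n))) ⊆ ⋃ k, S k → ∃ x : Fin n → A,
        (∀ k < i, ∀ θ ∈ Γ k, θ.Realize fun l => (x l : C)) ∧
          ∀ χ ∈ W, χ.Realize fun l => (x l : C) := by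
    intro i W hW
    obtain ⟨x, hx⟩ := hq.finitely_satisfiable
      (W ∪ ((Finset.range i).biUnion Γ).image (liftParams hAB)) (by
        intro χ hχ
        rcases Finset.mem_union.1 hχ with hχ | hχ
        · obtain ⟨k, hk⟩ := Set.mem_iUnion.1 (hW hχ)
          exact hk.1
        · obtain ⟨θ, hθ, rfl⟩ := Finset.mem_image.1 hχ
          obtain ⟨k, -, hθ⟩ := Finset.mem_biUnion.1 hθ
          exact hq.extends_type θ (hΓp k hθ))
    refine ⟨x, fun k hk θ hθ => (realize_liftParams hAB).1 (hx _ ?_),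
      fun χ hχ => hx χ (Finset.mem_union_left _ hχ)⟩
    exact Finset.mem_union_right _ (Finset.mem_image_of_mem _
      (Finset.mem_biUnion.2 ⟨k, Finset.mem_range.2 hk, hθ⟩))
  obtain ⟨a, ha⟩ := exists_seq_eventually_of_no_order
    (fun (x : Fin n → A) (χ : L[[B]].Formula (Fin n)) => χ.Realize fun l => (x l : C)) S
    (fun k x => ∀ θ ∈ Γ k, θ.Realize fun l => (x l : C)) hfin (by
      rintro k ⟨a, χ, haθ, hχ, hord⟩
      choose b hb using fun j => (hχ j).2
      exact hΓ k ⟨fun i l => (a i l : C), b, haθ, fun i j => (hb j _).symm.trans (hord i j)⟩)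
  refine ⟨a, fun χ hχ => ?_⟩
  obtain ⟨m, φ, b, hb⟩ := exists_formula_realize_iff χ
  obtain ⟨k, hk⟩ := he ⟨m, φ⟩
  refine ha k χ ⟨hχ, ?_⟩
  rw [hk]
  exact ⟨b, hb⟩

lemma isCountablyIncomplete_of_le_atTop {U : Ultrafilter ℕ} (hU : (U : Filter ℕ) ≤ atTop) :
    IsCountablyIncomplete U := by
  refine ⟨fun k => Set.Ici k, fun k => hU (mem_atTop k), fun h => ?_⟩
  have hempty : (⋂ k : ℕ, Set.Ici k) = (∅ : Set ℕ) :=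
    Set.eq_empty_of_forall_notMem fun x hx =>
      absurd (Set.mem_iInter.1 hx (x + 1)) (by simp)
  rw [hempty] at h
  exact U.empty_notMem h

/-- If every formula of a complete type holds along `U`, then the `U`-limit is that type. -/
lemma filterUltraproduct_eq_of_forall_mem [Nonempty C] {I : Type*} {U : Ultrafilter I} {A : Set C}
    {n : ℕ} {p : TypeOver L A n} {a : I → Fin n → C}
    (h : ∀ φ ∈ formulas p, ∀ᶠ i in U, φ.Realize (a i)) :
    filterUltraproduct U (fun i => formulas (tp L A (a i))) = formulas p := by
  ext φ
  have hφ : φ ∈ filterUltraproduct U (fun i => formulas (tp L A (a i))) ↔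
      ∀ᶠ i in U, φ.Realize (a i) :=
    eventually_congr (Eventually.of_forall fun i => mem_formulas_tp)
  rw [hφ]
  refine ⟨fun hU => ?_, h φ⟩
  by_contra hp
  obtain ⟨i, hi, hi'⟩ := (hU.and (h _ ((not_mem_formulas p φ).2 hp))).exists
  exact Formula.realize_not.1 hi' hi

end CoheirUltralimit

theorem mainTheorem9 {L : FirstOrder.Language.{u, v}} [Countable L.Symbols]
    {C : Type w} [L.Structure C] [Nonempty C]
    {κ : Cardinal.{w}} (hC : CoheirUltralimit.IsMonster L C κ)
    {A : Set C} (hA : Cardinal.mk A < κ) {n : ℕ} (p : CoheirUltralimit.TypeOver L A n)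
    (hdef : CoheirUltralimit.IsDefinableType p) (hst : CoheirUltralimit.IsStableType p)
    {B : Set C} (hAB : A ⊆ B) (q : CoheirUltralimit.TypeOver L B n)
    (hq : CoheirUltralimit.IsCoheir hAB p q) :
    ∃ U : Ultrafilter ℕ,
      CoheirUltralimit.IsCountablyIncomplete U ∧ CoheirUltralimit.IsUltralimit U p q := by
  obtain ⟨a, ha⟩ := CoheirUltralimit.exists_seq_eventually_realize hC hA hst hq
  refine ⟨Filter.hyperfilter ℕ,
    CoheirUltralimit.isCountablyIncomplete_of_le_atTop Nat.hyperfilter_le_atTop, a,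
    CoheirUltralimit.filterUltraproduct_eq_of_forall_mem fun φ hφ => ?_,
    CoheirUltralimit.filterUltraproduct_eq_of_forall_mem fun χ hχ =>
      Nat.hyperfilter_le_atTop (ha χ hχ)⟩
  exact Nat.hyperfilter_le_atTop ((ha _ (hq.extends_type φ hφ)).mono fun i hi =>
    (CoheirUltralimit.realize_liftParams hAB).1 hi)
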